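/- Conventions. Let $\pi$ be a set of primes and let $\pi'$ be the set of primes not in $\pi$. A finite group is a $\pi$-group if every prime dividing its order lies in $\pi$ (so for $\pi=\emptyset$ only the trivial group is one), and similarly for $\pi'$. A subgroup of a semigroup $S$ is a subsemigroup of $S$ that is a group (its identity need not be an identity of $S$). Let $\overline{\mathbf G}_\pi$ be the pseudovariety of finite semigroups all of whose subgroups are $\pi$-groups. A relational morphism $\varphi\colon T\to S$ of semigroups assigns to each $t\in T$ a nonempty subset $t\varphi\subseteq S$ such that $(t\varphi)(t'\varphi)\subseteq (tt')\varphi$ for all $t,t'\in T$; for $s\in S$ put $s\varphi^{-1}=\{t\in T\mid s\in t\varphi\}$. A subset $Z\subseteq T$ is $\overline{\mathbf G}_\pi$-pointlike if for every relational morphism $\varphi\colon T\to S$ with $S\in\overline{\mathbf G}_\pi$ there is $s\in S$ with $Z\subseteq s\varphi^{-1}$. For a finite semigroup $T$, the power semigroup $P(T)$ is the set of all subsets of $T$ with product $XY=\{xy\mid x\in X,\ y\in Y\}$; for $Z\in P(T)$ let $Z^{\omega}$ be the unique idempotent among the powers $Z^n$, $n\ge 1$, and put $Z^{\omega+\ast}=Z^{\omega}\cdot\bigcup_{n\geq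 1}Z^n$. Theorem. Let $\pi$ be a set of primes and $T$ a finite semigroup. Let $CP_\pi(T)$ be the smallest subsemigroup of $P(T)$ that contains all singletons $\{t\}$, $t\in T$, and is closed under $Z\mapsto Z^{\omega+\ast}$ for all its members $Z$ that generate a cyclic $\pi'$-group (that is, such that $\{Z^n\mid n\ge 1\}$ is a group whose order is divisible by no prime in $\pi$). Then a subset $X\subseteq T$ is $\overline{\mathbf G}_\pi$-pointlike if and only if $X\subseteq Y$ for some $Y\in CP_\pi(T)$. -/

import Mathlib

open scoped Pointwise

universe u v

namespace PiPointlike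

section Semigroups

variable {S : Type*} [Semigroup S]

/-- Positive powers in a semigroup: `posPow s n` is `s ^ (n + 1)`. -/
def posPow (s : S) : ℕ → S
  | 0 => s
  | n + 1 => posPow s n * s

theorem posPow_mul_posPow (s : S) (m n : ℕ) :
    posPow s m * posPow s n = posPow s (m + n + 1) := by
  induction n with
  | zero => rfl
  | succ k ih =>
    change posPow s m * (posPow s k * s) = posPow s (m + k + 1) * s
    rw [← mul_assoc, ih]

/-- In a finite semigroup, some positive power of each element is idempotent. -/
theorem exists_idempotent_posPow [Finite S] (s : S) :
    ∃ e : S, IsIdempotentElem e ∧ ∃ n : ℕ, e = posPow s n := by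
  obtain ⟨a, b, hab, h⟩ := Finite.exists_ne_map_eq_of_infinite (posPow s)
  wlog hlt : a < b generalizing a b
  · exact this b a hab.symm h.symm (by omega)
  obtain ⟨d, rfl⟩ : ∃ d, b = a + d + 1 := ⟨b - a - 1, by omega⟩
  have step : ∀ i, posPow s (a + i) = posPow s (a + i + (d + 1)) := by
    intro i
    rcases i with _ | i
    · simpa [add_assoc] using h
    · have := congrArg (· * posPow s i) h
      simp only [posPow_mul_posPow] at this
      rw [show a + (i + 1) = a + i + 1 by omega, this]
      congr 1
      omega
  have step' : ∀ k i, posPow s (a + i) = posPow s (a + i + k * (d + 1)) := by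
    intro k
    induction k with
    | zero => simp
    | succ k ih =>
      intro i
      rw [ih i, add_assoc a i, step (i + k * (d + 1))]
      congr 1
      ring
  refine ⟨posPow s (a + (a * d + d)), ?_, _, rfl⟩
  unfold IsIdempotentElem
  rw [posPow_mul_posPow, step' (a + 1) (a * d + d)]
  congr 1
  ring

/-- The idempotent positive power of `s` is unique. -/
theorem idempotent_posPow_unique (s e f : S) (he : IsIdempotentElem e) (hf : IsIdempotentElem f)
    (hes : ∃ n : ℕ, e = posPow s n) (hfs : ∃ n : ℕ, f = posPow s n) : e = f := by
  have key : ∀ g : S, IsIdempotentElem g → ∀ k, posPow g k = g := by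
    intro g hg k
    induction k with
    | zero => rfl
    | succ k ih => change posPow g k * g = g; rw [ih]; exact hg
  have pp : ∀ m k, posPow (posPow s m) k = posPow s (m * k + m + k) := by
    intro m k
    induction k with
    | zero => simp [posPow]
    | succ k ih =>
      change posPow (posPow s m) k * posPow s m = _
      rw [ih, posPow_mul_posPow]
      congr 1
      ring
  obtain ⟨m, rfl⟩ := hes
  obtain ⟨n, rfl⟩ := hfs
  rw [← key _ he n, pp, ← key _ hf m, pp]
  congr 1
  ring

/-- `s ^ ω`, the unique idempotent positive power of an element of a finite semigroup. -/
noncomputable def omegaPow [Finite S] (s : S) : S :=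
  Classical.choose (exists_idempotent_posPow s)

theorem omegaPow_spec [Finite S] (s : S) :
    IsIdempotentElem (omegaPow s) ∧ ∃ n : ℕ, omegaPow s = posPow s n :=
  Classical.choose_spec (exists_idempotent_posPow s)

/-- The subsemigroup `G` of `S` is a group (its identity `e` need not be an identity of `S`). -/
def IsSubgroup (G : Subsemigroup S) : Prop :=
  ∃ e ∈ G, ∀ g ∈ G, e * g = g ∧ g * e = g ∧ ∃ h ∈ G, g * h = e ∧ h * g = e

/-- The subsemigroup `G` (of a finite semigroup) is a `π`-group: it is a group, and all primes
dividing its order belong to `π`. -/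
def IsPiSubgroup (π : Set Nat.Primes) (G : Subsemigroup S) : Prop :=
  IsSubgroup G ∧ ∀ p : Nat.Primes, (p : ℕ) ∣ Nat.card G → p ∈ π

end Semigroups

/-- The class (pseudovariety) of finite semigroups all of whose subgroups are `π`-groups. -/
def GBar (π : Set Nat.Primes) (S : Type v) [Semigroup S] : Prop :=
  Finite S ∧ ∀ G : Subsemigroup S, IsSubgroup G → IsPiSubgroup π G

/-- A relational morphism `T → S`: `t φ = {s | rel t s}` is nonempty for every `t`, and
`(t φ) (t' φ) ⊆ (t t') φ`. -/
structure RelMorphism (T : Type u) (S : Type v) [Semigroup T] [Semigroup S] where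
  rel : T → S → Prop
  total : ∀ t, ∃ s, rel t s
  mul : ∀ {t t' s s'}, rel t s → rel t' s' → rel (t * t') (s * s')

/-- The inverse image `s φ⁻¹ = {t | s ∈ t φ}`. -/
def RelMorphism.inv {T : Type u} {S : Type v} [Semigroup T] [Semigroup S]
    (φ : RelMorphism T S) (s : S) : Set T :=
  {t | φ.rel t s}

/-- The collection of `V`-pointlike subsets of `T`, for a class `V` of semigroups. -/
def pointlikes (V : ∀ (S : Type v) [Semigroup S], Prop) (T : Type u) [Semigroup T] :
    Set (Set T) :=
  {Z | ∀ (S : Type v) [Semigroup S], V S → ∀ φ : RelMorphism T S, ∃ s : S, Z ⊆ φ.inv s}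

section PowerSemigroup

/- The power semigroup of `T` is `Set T` with the pointwise product. -/
attribute [local instance] Set.semigroup

variable {T : Type u} [Semigroup T] [Finite T]

/-- `Z ^ (ω + *) = Z ^ ω * ⋃ n ≥ 1, Z ^ n`, in the power semigroup of `T`. -/
noncomputable def omegaPlusStar (Z : Set T) : Set T :=
  omegaPow Z * ⋃ n : ℕ, posPow Z n

/-- `Z` generates a (necessarily cyclic) `π`-group in the power semigroup of `T`. -/
def GeneratesPiGroup (π : Set Nat.Primes) (Z : Set T) : Prop :=
  IsPiSubgroup π (Subsemigroup.closure {Z})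

/-- The smallest subsemigroup of the power semigroup of `T` that contains the singletons and is
closed under `Z ↦ Z ^ (ω + *)` whenever `Z` generates a cyclic `π'`-group, where `π' = πᶜ`. -/
noncomputable def CP (π : Set Nat.Primes) (T : Type u) [Semigroup T] [Finite T] :
    Subsemigroup (Set T) :=
  sInf {U | (∀ t : T, {t} ∈ U) ∧ ∀ Z ∈ U, GeneratesPiGroup πᶜ Z → omegaPlusStar Z ∈ U}

end PowerSemigroup

end PiPointlike

/-! Members of `CP` are pointlike by coprimality. If `Z ⊆ s φ⁻¹` and `Z` has period a `π'`-number
`m`, while the powers of `s` have eventual period a `π`-number `r`, then every exponent can be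
changed modulo `m` to a large multiple of `r`. All powers of `Z` are thus covered by one power of
`s`, hence so is their union (`GBar.omegaPlusStar_mem_covered`).

For the converse, adjoin an identity to `CP π T` and order it by inclusion. In this finite ordered
monoid `M`, powers of an element generating a `π'`-group have a join, and products preserve it
(`PiComplete`). For every finite alphabet `A` and map `A → M` there is then a map from `A` to a
finite `π`-aperiodic monoid `N` such that words with equal value in `N` have a common upper bound in
`M` (`hasBoundedFibers_of_card`). With `A = T`, relating the value of a word in `T` to its value in
`N` is a relational morphism; a pointlike set lies over one point of `N`, so the upper bound
contains it.

The existence of `N` is proved by induction on the sizes of `M` and of `A`. If all letters are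
units, `N` is the unit group modulo the normal closure of its `π'`-elements. Otherwise fix a letter
`c` whose image is not a unit and cut words at `c`. The blocks between occurrences of `c` use a
smaller alphabet; the sequence of inner blocks is evaluated in the local divisor at the image of
`c`, which is smaller than `M`. A Rees matrix extension assembles the two resulting monoids. -/

namespace PiPointlike

/-! ### Arithmetic of `π`-numbers -/

/-- All prime divisors of `n` belong to `π`. -/
def IsPiNumber (π : Set Nat.Primes) (n : ℕ) : Prop :=
  ∀ p : Nat.Primes, (p : ℕ) ∣ n → p ∈ π

theorem IsPiNumber.coprime {π : Set Nat.Primes} {a b : ℕ} (ha : IsPiNumber π a)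
    (hb : IsPiNumber πᶜ b) : a.Coprime b :=
  Nat.Coprime.symm <| Nat.coprime_of_dvd fun p hp h₁ h₂ => hb ⟨p, hp⟩ h₁ (ha ⟨p, hp⟩ h₂)

theorem IsPiNumber.of_dvd {π : Set Nat.Primes} {a b : ℕ} (hb : IsPiNumber π b) (h : a ∣ b) :
    IsPiNumber π a :=
  fun p hp => hb p (hp.trans h)

theorem isPiNumber_one (π : Set Nat.Primes) : IsPiNumber π 1 :=
  fun p hp => absurd (Nat.dvd_one.1 hp) p.2.ne_one

theorem IsPiNumber.mul {π : Set Nat.Primes} {a b : ℕ} (ha : IsPiNumber π a)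
    (hb : IsPiNumber π b) : IsPiNumber π (a * b) :=
  fun p hp => (p.2.dvd_mul.1 hp).elim (ha p) (hb p)

theorem isPiNumber_prime {π : Set Nat.Primes} {p : ℕ} (hp : p.Prime)
    (h : (⟨p, hp⟩ : Nat.Primes) ∈ π) : IsPiNumber π p := by
  intro q hq
  rwa [show q = ⟨p, hp⟩ from Subtype.ext ((Nat.prime_dvd_prime_iff_eq q.2 hp).1 hq)]

theorem exists_isPiNumber_mul (π : Set Nat.Primes) (n : ℕ) (hn : n ≠ 0) :
    ∃ a b, n = a * b ∧ IsPiNumber π a ∧ IsPiNumber πᶜ b := by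
  induction n using Nat.recOnMul with
  | zero => exact absurd rfl hn
  | one => exact ⟨1, 1, rfl, isPiNumber_one _, isPiNumber_one _⟩
  | prime p hp =>
    by_cases h : (⟨p, hp⟩ : Nat.Primes) ∈ π
    · exact ⟨p, 1, (mul_one p).symm, isPiNumber_prime hp h, isPiNumber_one _⟩
    · exact ⟨1, p, (one_mul p).symm, isPiNumber_one _, isPiNumber_prime hp h⟩
  | mul x y hx hy =>
    obtain ⟨a, b, h, ha, hb⟩ := hx (left_ne_zero_of_mul hn)
    obtain ⟨a', b', h', ha', hb'⟩ := hy (right_ne_zero_of_mul hn)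
    exact ⟨a * a', b * b', by rw [h, h']; ring, ha.mul ha', hb.mul hb'⟩

/-! ### Powers, periods and subgroups of semigroups -/

theorem posPow_eq_pow {M : Type*} [Monoid M] (x : M) (n : ℕ) : posPow x n = x ^ (n + 1) := by
  induction n with
  | zero => simp [posPow]
  | succ n ih => rw [posPow, ih, pow_succ _ (n + 1)]

theorem map_posPow {S R F : Type*} [Semigroup S] [Semigroup R] [FunLike F S R] [MulHomClass F S R]
    (f : F) (s : S) (n : ℕ) : f (posPow s n) = posPow (f s) n := by
  induction n with
  | zero => rfl
  | succ n ih => rw [posPow, map_mul, ih, posPow]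

/-- An elementwise description of the semigroups whose subgroups are `π`-groups. -/
def PiAperiodic (π : Set Nat.Primes) (S : Type*) [Semigroup S] : Prop :=
  ∀ p : Nat.Primes, p ∉ π → ∀ z : S, posPow z p = z → z * z = z

theorem PiAperiodic.of_injective {π : Set Nat.Primes} {S R : Type*} [Semigroup S] [Semigroup R]
    (hS : PiAperiodic π S) (f : R →ₙ* S) (hf : Function.Injective f) : PiAperiodic π R := by
  intro p hp z hz
  apply hf
  rw [map_mul]
  exact hS p hp _ (by rw [← map_posPow, hz])

/-- The group structure on a subgroup of a semigroup. -/
noncomputable abbrev IsSubgroup.group {S : Type*} [Semigroup S] {G : Subsemigroup S}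
    (hG : IsSubgroup G) : Group G :=
  let e := Classical.choose hG
  have he := Classical.choose_spec hG
  letI : One G := ⟨⟨e, he.1⟩⟩
  letI : Inv G := ⟨fun g => ⟨Classical.choose (he.2 g g.2).2.2,
    (Classical.choose_spec (he.2 g g.2).2.2).1⟩⟩
  Group.ofLeftAxioms mul_assoc (fun g => Subtype.ext (he.2 g g.2).1)
    (fun g => Subtype.ext (Classical.choose_spec (he.2 g g.2).2.2).2.2)

/-- Cauchy's theorem: a prime `p ∉ π` dividing the order of a subgroup gives `g` of order `p`, so `g
^ (p + 1) = g` with `g` not idempotent. -/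
theorem PiAperiodic.gBar {π : Set Nat.Primes} {S : Type v} [Semigroup S] [Finite S]
    (hS : PiAperiodic π S) : GBar π S := by
  refine ⟨inferInstance, fun G hG => ⟨hG, fun p hp => ?_⟩⟩
  by_contra hpπ
  let _ := hG.group
  have := Fact.mk p.2
  obtain ⟨g, hg⟩ := exists_prime_orderOf_dvd_card' (G := G) (p : ℕ) hp
  have h1 : posPow g p = g := by rw [posPow_eq_pow, pow_succ, ← hg, pow_orderOf_eq_one, one_mul]
  have h2 : g * g = g :=
    (hS.of_injective (MulMemClass.subtype G) Subtype.val_injective) p hpπ g h1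
  rw [mul_eq_left] at h2
  rw [h2, orderOf_one] at hg
  exact p.2.one_lt.ne hg

theorem IsSubgroup.posPow_coe {S : Type*} [Semigroup S] {G : Subsemigroup S}
    (hG : IsSubgroup G) (g : G) (n : ℕ) :
    letI := hG.group
    posPow (g : S) n = ((g ^ (n + 1) : G) : S) := by
  let _ := hG.group
  change _ = ((g ^ (n + 1) : G) : S)
  rw [← posPow_eq_pow]
  exact (map_posPow (MulMemClass.subtype G) g n).symm

/-- In a subgroup of order `r`, one has `g ^ (r + 1) = g`. -/
theorem IsSubgroup.posPow_card {S : Type*} [Semigroup S] [Finite S] {G : Subsemigroup S}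
    (hG : IsSubgroup G) {g : S} (hg : g ∈ G) :
    posPow g (Nat.card G) = g ∧ 0 < Nat.card G := by
  let _ := hG.group
  have hc : (⟨g, hg⟩ : G) ^ Nat.card G = 1 := pow_card_eq_one'
  refine ⟨?_, Nat.card_pos⟩
  rw [hG.posPow_coe ⟨g, hg⟩, pow_succ, hc, one_mul]

theorem mem_closure_singleton_iff {S : Type*} [Semigroup S] {s x : S} :
    x ∈ Subsemigroup.closure {s} ↔ ∃ n, posPow s n = x := by
  constructor
  · intro h
    induction h using Subsemigroup.closure_induction with
    | mem x hx => exact ⟨0, hx.symm⟩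
    | mul x y _ _ hx hy =>
      obtain ⟨m, rfl⟩ := hx
      obtain ⟨n, rfl⟩ := hy
      exact ⟨_, (posPow_mul_posPow s m n).symm⟩
  · rintro ⟨n, rfl⟩
    induction n with
    | zero => exact Subsemigroup.subset_closure rfl
    | succ n ih => exact mul_mem ih (Subsemigroup.subset_closure rfl)

theorem posPow_add_mul {S : Type*} [Semigroup S] {s : S} {k m : ℕ}
    (h : posPow s (k + m) = posPow s k) (n j : ℕ) (hn : k ≤ n) :
    posPow s (n + j * m) = posPow s n := by
  have step : ∀ i, posPow s (k + i + m) = posPow s (k + i) := by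
    intro i
    cases i with
    | zero => simpa using h
    | succ i =>
      have := congrArg (· * posPow s i) h
      simp only [posPow_mul_posPow] at this
      rw [show k + (i + 1) + m = k + m + i + 1 by omega, this, add_assoc]
  induction j with
  | zero => simp
  | succ j ih =>
    rw [← ih, add_mul, one_mul, ← add_assoc]
    obtain ⟨i, rfl⟩ := Nat.exists_eq_add_of_le hn
    rw [show k + i + j * m + m = k + (i + j * m) + m by omega, step, add_assoc]

/-- The subsemigroup generated by a periodic element is a group. -/
theorem isSubgroup_closure_singleton {S : Type*} [Semigroup S] {s : S} {m : ℕ} (hm : 0 < m)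
    (h : posPow s m = s) : IsSubgroup (Subsemigroup.closure {s}) := by
  have per : ∀ n j, posPow s (n + j * m) = posPow s n := fun n j =>
    posPow_add_mul (k := 0) (by rw [zero_add, h]; rfl) n j (Nat.zero_le n)
  refine ⟨posPow s (m - 1), mem_closure_singleton_iff.2 ⟨_, rfl⟩, fun g hg => ?_⟩
  obtain ⟨n, rfl⟩ := mem_closure_singleton_iff.1 hg
  -- As `posPow` shifts exponents by one, the identity is `s ^ m` and the inverse of `s ^ (n + 1)`
  -- is `s ^ ((n + 1) * (m - 1) + m)`; the extra `m` keeps the exponent positive when `m = 1`.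
  refine ⟨?_, ?_, posPow s ((n + 1) * (m - 1) + (m - 1)), mem_closure_singleton_iff.2 ⟨_, rfl⟩, ?_, ?_⟩
  · rw [posPow_mul_posPow, show m - 1 + n + 1 = n + 1 * m by omega, per]
  · rw [posPow_mul_posPow, show n + (m - 1) + 1 = n + 1 * m by omega, per]
  all_goals
    obtain ⟨m, rfl⟩ : ∃ k, m = k + 1 := ⟨m - 1, by omega⟩
    rw [posPow_mul_posPow, ← per (m + 1 - 1) (n + 1)]
    congr 1
    simp only [Nat.add_sub_cancel]
    ring

/-- The order of the subsemigroup generated by a periodic element divides each period. -/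
theorem card_closure_singleton_dvd {S : Type*} [Semigroup S] [Finite S] {s : S} {m : ℕ}
    (hm : 0 < m) (h : posPow s m = s) : Nat.card (Subsemigroup.closure {s}) ∣ m := by
  have hG := isSubgroup_closure_singleton hm h
  letI := hG.group
  let g : Subsemigroup.closure {s} := ⟨s, Subsemigroup.subset_closure rfl⟩
  have hg : ∀ x, x ∈ Submonoid.powers g := by
    rintro ⟨x, hx⟩
    obtain ⟨n, rfl⟩ := mem_closure_singleton_iff.1 hx
    refine (Submonoid.mem_powers_iff _ _).2 ⟨n + 1, ?_⟩
    exact Subtype.ext (hG.posPow_coe g n).symm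
  have h1 : g ^ (m + 1) = g := Subtype.ext ((hG.posPow_coe g m).symm.trans h)
  rw [pow_succ, mul_eq_right] at h1
  rw [← orderOf_eq_card_of_forall_mem_zpowers (g := g)
    fun x => (mem_powers_iff_mem_zpowers.1 (hg x))]
  exact orderOf_dvd_of_pow_eq_one h1

/-- In a semigroup with only `π`-subgroups, powers are eventually periodic with a period that is a
`π`-number. -/
theorem GBar.exists_period {π : Set Nat.Primes} {S : Type v} [Semigroup S] (hS : GBar π S)
    (s : S) : ∃ k r, 0 < r ∧ IsPiNumber π r ∧ posPow s (k + r) = posPow s k := by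
  have := hS.1
  obtain ⟨e, he, n, rfl⟩ := exists_idempotent_posPow s
  rw [IsIdempotentElem, posPow_mul_posPow] at he
  have per := posPow_add_mul (m := n + 1) (k := n) (s := s) (by rw [← he]; rfl)
  -- With `e = s ^ (n + 1)` idempotent, `g = e * s` generates a group with identity `e`; its order
  -- is the period sought.
  set g := posPow s (n + 1) with hg
  have hpow : ∀ j, posPow g j = posPow s (n + j + 1) := by
    intro j
    induction j with
    | zero => rfl
    | succ j ih =>
      rw [posPow, ih, hg, posPow_mul_posPow,
        show n + j + 1 + (n + 1) + 1 = n + (j + 1) + 1 + 1 * (n + 1) by omega, per _ _ (by omega)]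
  have hgm : posPow g (n + 1) = g := by
    rw [hpow, hg, show n + (n + 1) + 1 = n + 1 + 1 * (n + 1) by omega, per _ _ (by omega)]
  have hG := isSubgroup_closure_singleton (Nat.succ_pos n) hgm
  obtain ⟨h, h0⟩ := hG.posPow_card (Subsemigroup.subset_closure rfl)
  refine ⟨n + 1, _, h0, (hS.2 _ hG).2, ?_⟩
  rw [hpow] at h
  rw [add_right_comm, h]

/-- Chinese remainder theorem, with a multiple of `a * m` added to pass the threshold `k`. It moves
an exponent modulo `m` to a large multiple of `a`. -/
theorem exists_add_mul_dvd {a m : ℕ} (ha : 0 < a) (hm : 0 < m) (h : a.Coprime m) (i k : ℕ) :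
    ∃ j, k ≤ i + j * m ∧ a ∣ i + j * m := by
  obtain ⟨x, hx1, hx2⟩ := Nat.chineseRemainder h 0 i
  have hle : i + k ≤ x + (i + k) * (a * m) :=
    (Nat.le_mul_of_pos_right _ (Nat.mul_pos ha hm)).trans (Nat.le_add_left _ _)
  have hmod : i ≡ x + (i + k) * (a * m) [MOD m] := by
    have : (i + k) * (a * m) ≡ 0 [MOD m] := (Nat.modEq_zero_iff_dvd).2 ⟨(i + k) * a, by ring⟩
    simpa using hx2.symm.add this.symm
  obtain ⟨j, hj⟩ := (Nat.modEq_iff_dvd' (by omega)).1 hmod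
  have hX : i + j * m = x + (i + k) * (a * m) := by rw [mul_comm j, ← hj]; omega
  refine ⟨j, by omega, ?_⟩
  rw [hX]
  exact dvd_add ((Nat.modEq_zero_iff_dvd).1 hx1) ⟨(i + k) * m, by ring⟩

/-! ### Ordered monoids with joins of `π'`-cycles -/

/-- Every element generating a `π'`-group has a join of its powers, distributing over products. -/
def PiComplete (π : Set Nat.Primes) (M : Type*) [Monoid M] [PartialOrder M] : Prop :=
  ∀ (z : M) (m : ℕ), 0 < m → IsPiNumber πᶜ m → z ^ (m + 1) = z →
    ∃ Y, ∀ a b, IsLUB (Set.range fun n : ℕ => a * z ^ (n + 1) * b) (a * Y * b)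

/-- Two elements of a finite monoid have powers with a common exponent and `π'`-period, the
exponent being prescribed modulo a `π'`-number. -/
theorem exists_exponent {M : Type*} [Monoid M] {π : Set Nat.Primes} [Finite M]
    (x y : M) {m : ℕ} (hm : 0 < m)
    (hmπ : IsPiNumber πᶜ m) :
    ∃ j r, 0 < r ∧ IsPiNumber πᶜ r ∧ (x ^ (1 + j * m)) ^ (r + 1) = x ^ (1 + j * m) ∧
      (y ^ (1 + j * m)) ^ (r + 1) = y ^ (1 + j * m) := by
  obtain ⟨e, he, n, hn⟩ := exists_idempotent_posPow (x, y)
  rw [hn, IsIdempotentElem, posPow_mul_posPow] at he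
  have per := posPow_add_mul (m := n + 1) (k := n) (s := (x, y)) (by rw [← add_assoc, he])
  obtain ⟨a, r, har, ha, hr⟩ := exists_isPiNumber_mul π (n + 1) (Nat.succ_ne_zero n)
  have ha0 : 0 < a := Nat.pos_of_ne_zero (by rintro rfl; simp at har)
  have hr0 : 0 < r := Nat.pos_of_ne_zero (by rintro rfl; simp at har)
  -- The exponent is `1` modulo `m`, beyond the preperiod of `(x, y)`, and divisible by the `π`-part
  -- `a` of its period `n + 1 = a * r`; only the `π'`-part `r` remains as a period.
  obtain ⟨j, hj, q, hq⟩ := exists_add_mul_dvd ha0 hm (ha.coprime hmπ) 1 (n + 1)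
  have key : ((x, y) ^ (1 + j * m)) ^ (r + 1) = (x, y) ^ (1 + j * m) := by
    have := per (j * m) q (by omega)
    rw [posPow_eq_pow, posPow_eq_pow] at this
    rw [← pow_mul, add_comm 1 (j * m), ← this]
    congr 1
    rw [har, mul_add, mul_one, add_comm (j * m) 1, hq]
    rw [← add_comm 1, ← add_assoc, hq]
    ring
  rw [Prod.pow_mk, Prod.pow_mk, Prod.mk.injEq] at key
  exact ⟨j, r, hr0, hr, key.1, key.2⟩

/-! ### Local divisors -/

/-- The local divisor `M c ∩ c M` of a monoid at `c`. -/
@[ext]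
structure LocalDivisor {M : Type*} [Monoid M] (c : M) where
  val : M
  left : ∃ u, val = u * c
  right : ∃ v, val = c * v

namespace LocalDivisor

variable {M : Type*} [Monoid M] {c : M}

/-- The product is `(u * c) ∘ (c * v) = u * c * v`; the choice of `u` is immaterial because the
second factor lies in `c M`. The identity is `c`. -/
noncomputable instance : Mul (LocalDivisor c) where
  mul x y := ⟨Classical.choose x.left * y.val, by
    obtain ⟨u, hu⟩ := y.left
    exact ⟨Classical.choose x.left * u, by rw [hu, mul_assoc]⟩, by
    obtain ⟨v, hv⟩ := y.right
    obtain ⟨w, hw⟩ := x.right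
    refine ⟨w * v, ?_⟩
    rw [hv, ← mul_assoc, ← Classical.choose_spec x.left, hw, mul_assoc]⟩

theorem mul_val_of_right (x y : LocalDivisor c) {v : M} (h : y.val = c * v) :
    (x * y).val = x.val * v := by
  change Classical.choose x.left * y.val = _
  rw [h, ← mul_assoc, ← Classical.choose_spec x.left]

theorem mul_val_of_left (x y : LocalDivisor c) {u : M} (h : x.val = u * c) :
    (x * y).val = u * y.val := by
  obtain ⟨v, hv⟩ := y.right
  rw [mul_val_of_right x y hv, h, hv, mul_assoc]

instance : One (LocalDivisor c) := ⟨⟨c, ⟨1, (one_mul c).symm⟩, ⟨1, (mul_one c).symm⟩⟩⟩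

theorem one_val : (1 : LocalDivisor c).val = c := rfl

noncomputable instance : Monoid (LocalDivisor c) where
  mul_assoc x y z := LocalDivisor.ext <| by
    obtain ⟨u, hu⟩ := x.left
    obtain ⟨v, hv⟩ := z.right
    rw [mul_val_of_right _ z hv, mul_val_of_left x _ hu, mul_val_of_left x _ hu,
      mul_val_of_right _ z hv, mul_assoc]
  one_mul x := LocalDivisor.ext <| by
    rw [mul_val_of_left 1 x (u := 1) (one_mul c).symm, one_mul]
  mul_one x := LocalDivisor.ext <| by
    rw [mul_val_of_right x 1 (v := 1) (mul_one c).symm, mul_one]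

theorem pow_val_left (z : LocalDivisor c) {x : M} (h : z.val = x * c) (n : ℕ) :
    (z ^ n).val = x ^ n * c := by
  induction n with
  | zero => rw [pow_zero, pow_zero, one_mul, one_val]
  | succ n ih => rw [pow_succ', mul_val_of_left z _ h, ih, pow_succ', mul_assoc]

theorem pow_val_right (z : LocalDivisor c) {y : M} (h : z.val = c * y) (n : ℕ) :
    (z ^ n).val = c * y ^ n := by
  induction n with
  | zero => rw [pow_zero, pow_zero, mul_one, one_val]
  | succ n ih => rw [pow_succ, mul_val_of_right _ z h, ih, pow_succ, mul_assoc]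

instance [Finite M] : Finite (LocalDivisor c) := 
  Finite.of_injective val fun _ _ => LocalDivisor.ext

/-- The identity of `M` lies in `M c ∩ c M` only if `c` is a unit. -/
theorem card_lt [Finite M] (hc : ¬ IsUnit c) : Nat.card (LocalDivisor c) < Nat.card M := by
  have := Fintype.ofFinite M
  have := Fintype.ofFinite (LocalDivisor c)
  rw [Nat.card_eq_fintype_card, Nat.card_eq_fintype_card]
  refine Fintype.card_lt_of_injective_of_notMem val (fun _ _ => LocalDivisor.ext) (b := 1) ?_
  rintro ⟨x, hx⟩
  obtain ⟨u, hu⟩ := x.left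
  obtain ⟨v, hv⟩ := x.right
  rw [hx] at hu hv
  exact hc (isUnit_iff_exists_and_exists.2 ⟨⟨v, hv.symm⟩, ⟨u, hu.symm⟩⟩)

variable [PartialOrder M]

instance : PartialOrder (LocalDivisor c) := 
  PartialOrder.lift val fun _ _ => LocalDivisor.ext

theorem le_def (x y : LocalDivisor c) : x ≤ y ↔ x.val ≤ y.val := Iff.rfl

instance [MulLeftMono M] : MulLeftMono (LocalDivisor c) where
  elim x y z h := by
    obtain ⟨u, hu⟩ := x.left
    change x * y ≤ x * z
    rw [le_def, mul_val_of_left x _ hu, mul_val_of_left x _ hu]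
    exact mul_le_mul_right ((le_def _ _).1 h) u

instance [MulRightMono M] : MulRightMono (LocalDivisor c) where
  elim x y z h := by
    obtain ⟨v, hv⟩ := x.right
    change y * x ≤ z * x
    rw [le_def, mul_val_of_right _ x hv, mul_val_of_right _ x hv]
    exact mul_le_mul_left ((le_def _ _).1 h) v

/-- Write `z = x * c = c * y`. The elements `x` and `y` need not generate `π'`-groups, but suitable
powers do, with exponent `1` modulo `m` so that `z` is unchanged. Their joins `X`, `Y` satisfy `X *
c = c * Y`, both being the join of the powers of `z`; this common value is the join in the local
divisor. -/
theorem piComplete {π : Set Nat.Primes} [Finite M] (hM : PiComplete π M) (c : M) :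
    PiComplete π (LocalDivisor c) := by
  intro z m hm hmπ hz
  obtain ⟨x, hx⟩ := z.left
  obtain ⟨y, hy⟩ := z.right
  obtain ⟨j, r, hr, hrπ, hxr, hyr⟩ := exists_exponent x y hm hmπ
  obtain ⟨X, hX⟩ := hM _ r hr hrπ hxr
  obtain ⟨Y, hY⟩ := hM _ r hr hrπ hyr
  have hzk : z ^ (1 + j * m) = z := by
    clear hxr hyr hX hY
    induction j with
    | zero => simp
    | succ j ih => rw [add_mul, one_mul, ← add_assoc, pow_add, ih, ← pow_succ', hz]
  have hxz : ∀ n, (x ^ (1 + j * m)) ^ n * c = (z ^ n).val := fun n => by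
    rw [← pow_mul, ← pow_val_left z hx, pow_mul, hzk]
  have hyz : ∀ n, c * (y ^ (1 + j * m)) ^ n = (z ^ n).val := fun n => by
    rw [← pow_mul, ← pow_val_right z hy, pow_mul, hzk]
  have hXY : X * c = c * Y := by
    have h1 := hX 1 c
    have h2 := hY c 1
    simp only [one_mul, mul_one, hxz, hyz] at h1 h2
    exact h1.unique h2
  refine ⟨⟨X * c, ⟨X, rfl⟩, Y, hXY⟩, fun a b => ?_⟩
  obtain ⟨a', ha⟩ := a.left
  obtain ⟨b', hb⟩ := b.right
  have hval : ∀ w : LocalDivisor c, (a * w * b).val = a' * w.val * b' := fun w => by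
    rw [mul_val_of_right _ b hb, mul_val_of_left a w ha]
  have h := hX a' (c * b')
  have hr' : ∀ w, a' * w * (c * b') = a' * (w * c) * b' := fun w => by simp only [mul_assoc]
  simp only [hr', hxz] at h
  constructor
  · rintro _ ⟨n, rfl⟩
    rw [le_def, hval, hval]
    exact h.1 ⟨n, rfl⟩
  · intro d hd
    rw [le_def, hval]
    refine h.2 ?_
    rintro _ ⟨n, rfl⟩
    have := hd ⟨n, rfl⟩
    rwa [le_def, hval] at this

end LocalDivisor

/-! ### A Rees matrix extension -/

/-- The disjoint union of a monoid `B` with a Rees matrix semigroup over `D`. -/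
inductive ReesExtension {B D : Type u} (f : B → D) : Type u
  | low (b : B) : ReesExtension f
  | high (x : B) (d : D) (y : B) : ReesExtension f

namespace ReesExtension

variable {B D : Type u} [Monoid B] [Monoid D] {f : B → D}

/-- A triple `high x d y` stands for a word with a marked letter: `x` and `y` are the values of its
outer blocks and `d` that of its inner blocks. Multiplying two triples makes `y * x'` a new inner
block, recorded through `f`. -/
instance : Mul (ReesExtension f) where
  mul
    | low b, low b' => low (b * b')
    | low b, high x d y => high (b * x) d y
    | high x d y, low b => high x d (y * b)
    | high x d y, high x' d' y' => high x (d * f (y * x') * d') y'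

theorem low_mul_low (b b' : B) : (low b * low b' : ReesExtension f) = low (b * b') := rfl

theorem low_mul_high (b x y : B) (d : D) :
    (low b * high x d y : ReesExtension f) = high (b * x) d y := rfl

theorem high_mul_low (b x y : B) (d : D) :
    (high x d y * low b : ReesExtension f) = high x d (y * b) := rfl

theorem high_mul_high (x y x' y' : B) (d d' : D) :
    (high x d y * high x' d' y' : ReesExtension f) = high x (d * f (y * x') * d') y' := rfl

instance : Monoid (ReesExtension f) where
  one := low 1
  mul_assoc a b c := by
    cases a <;> cases b <;> cases c <;>
      simp only [low_mul_low, low_mul_high, high_mul_low, high_mul_high, mul_assoc]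
  one_mul a := by
    cases a
    · exact congrArg low (one_mul _)
    · exact congrArg (high · _ _) (one_mul _)
  mul_one a := by
    cases a
    · exact congrArg low (mul_one _)
    · exact congrArg (high _ _) (mul_one _)

instance [Finite B] [Finite D] : Finite (ReesExtension f) :=
  Finite.of_surjective (α := B ⊕ (B × D × B))
    (Sum.elim low fun t => high t.1 t.2.1 t.2.2) <| by
      rintro (b | ⟨x, d, y⟩)
      · exact ⟨.inl b, rfl⟩
      · exact ⟨.inr (x, d, y), rfl⟩

theorem posPow_low (b : B) (n : ℕ) : posPow (low b : ReesExtension f) n = low (posPow b n) := by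
  induction n with
  | zero => rfl
  | succ n ih => rw [posPow, ih, low_mul_low, posPow]

theorem posPow_high (x y : B) (d : D) (n : ℕ) :
    posPow (high x d y : ReesExtension f) n = high x (d * (f (y * x) * d) ^ n) y := by
  induction n with
  | zero => rw [pow_zero, mul_one, posPow]
  | succ n ih => rw [posPow, ih, high_mul_high, pow_succ]; simp only [mul_assoc]

theorem piAperiodic {π : Set Nat.Primes} (hB : PiAperiodic π B) (hD : PiAperiodic π D) :
    PiAperiodic π (ReesExtension f) := by
  rintro p hp (b | ⟨x, d, y⟩) h
  · rw [posPow_low] at h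
    rw [low_mul_low, hB p hp b (low.inj h)]
  · rw [posPow_high] at h
    have h1 : d * (f (y * x) * d) ^ (p : ℕ) = d := (high.inj h).2.1
    -- Multiplying `h1` on the left by `f (y * x)` shows that `f (y * x) * d` has period `p` in `D`,
    -- hence is idempotent; then `h1` collapses to `d * (f (y * x) * d) = d`.
    have h2 : (f (y * x) * d) * (f (y * x) * d) = f (y * x) * d := by
      apply hD p hp
      rw [posPow_eq_pow, pow_succ', mul_assoc, h1]
    have h3 : ∀ n, (f (y * x) * d) ^ (n + 1) = f (y * x) * d := by
      intro n
      induction n with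
      | zero => rw [zero_add, pow_one]
      | succ n ih => rw [pow_succ, ih, h2]
    rw [← Nat.sub_add_cancel p.2.one_lt.le, h3] at h1
    rw [high_mul_high, mul_assoc, h1]

end ReesExtension

/-! ### Units modulo the `π'`-elements -/

theorem exists_isPiNumber_pow_eq_one {G : Type*} [Group G] [Finite G] {p : ℕ} (hp : p.Prime)
    (g : G) : ∃ a m, g ^ (p ^ a * m) = 1 ∧ ¬ p ∣ m := by
  obtain ⟨a, m, hm, h⟩ := Nat.exists_eq_pow_mul_and_not_dvd (orderOf_pos g).ne' p hp.ne_one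
  exact ⟨a, m, by rw [← h, pow_orderOf_eq_one], hm⟩

/-- The elements of a group whose order is a `π`-number. -/
def piElements (π : Set Nat.Primes) (G : Type*) [Group G] : Set G :=
  {g | ∃ m, 0 < m ∧ IsPiNumber π m ∧ g ^ m = 1}

theorem isPiNumber_prime_pow {π : Set Nat.Primes} {p : Nat.Primes} (hp : p ∈ π) (a : ℕ) :
    IsPiNumber π ((p : ℕ) ^ a) :=
  fun q hq => by
    rwa [Nat.Primes.coe_nat_injective ((Nat.prime_dvd_prime_iff_eq q.2 p.2).1
      (q.2.dvd_of_dvd_pow hq))]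

/-- If the class of `g` is killed by `p ∉ π` and `g` has order `p ^ a * m` with `p ∤ m`, then `g ^
m` is a `π'`-element. So the class is killed by `m` too, and is trivial. -/
theorem piAperiodic_quotient (π : Set Nat.Primes) (G : Type*) [Group G] [Finite G] :
    PiAperiodic π (G ⧸ Subgroup.normalClosure (piElements πᶜ G)) := by
  intro p hp z hz
  rw [posPow_eq_pow, pow_succ, mul_eq_right] at hz
  obtain ⟨g, rfl⟩ := QuotientGroup.mk_surjective z
  obtain ⟨a, m, h1, hm⟩ := exists_isPiNumber_pow_eq_one p.2 g
  have h2 : (g : G ⧸ Subgroup.normalClosure (piElements πᶜ G)) ^ m = 1 := by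
    rw [← QuotientGroup.mk_pow, QuotientGroup.eq_one_iff]
    refine Subgroup.subset_normalClosure ⟨(p : ℕ) ^ a, pow_pos p.2.pos a,
      isPiNumber_prime_pow hp a, ?_⟩
    rw [← pow_mul, mul_comm, h1]
  have h3 : (g : G ⧸ Subgroup.normalClosure (piElements πᶜ G)) = 1 := by
    have hco : Nat.Coprime p m := (Nat.Prime.coprime_iff_not_dvd p.2).2 hm
    rw [← pow_one (g : G ⧸ Subgroup.normalClosure (piElements πᶜ G)), ← hco.gcd_eq_one]
    exact pow_gcd_eq_one.2 ⟨hz, h2⟩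
  rw [h3, mul_one]

theorem conj_mem_piElements {π : Set Nat.Primes} {G : Type*} [Group G] {g : G}
    (hg : g ∈ piElements π G) (h : G) : h * g * h⁻¹ ∈ piElements π G := by
  obtain ⟨m, h0, hm, h1⟩ := hg
  exact ⟨m, h0, hm, by rw [conj_pow, h1, mul_one, mul_inv_cancel]⟩

variable {π : Set Nat.Primes} {M : Type u} [Monoid M] [PartialOrder M] [MulLeftMono M]
  [MulRightMono M]

/-- The normal subgroup generated by the `π'`-units is bounded above. -/
theorem PiComplete.exists_bound_normalClosure [Finite M] (hM : PiComplete π M) :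
    ∃ Y : M, ∀ g ∈ Subgroup.normalClosure (piElements πᶜ Mˣ), (g : M) ≤ Y := by
  -- The join of the powers of a `π'`-unit lies above both the unit and `1`, so a product of such
  -- joins lies above every unit involved.
  have hb : ∀ s : Set Mˣ, s.Finite → s ⊆ piElements πᶜ Mˣ →
      ∃ Y : M, 1 ≤ Y ∧ ∀ g ∈ s, (g : M) ≤ Y := by
    intro s hs
    induction s, hs using Set.Finite.induction_on with
    | empty => exact fun _ => ⟨1, le_rfl, by simp⟩
    | @insert g s _ _ ih =>
      intro hsub
      obtain ⟨Y, hY1, hY⟩ := ih fun x hx => hsub (Set.mem_insert_of_mem _ hx)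
      obtain ⟨m, h0, hm, h1⟩ := hsub (Set.mem_insert g s)
      obtain ⟨Z, hZ⟩ := hM (g : M) m h0 hm (by
        rw [pow_succ, ← Units.val_pow_eq_pow_val, h1, Units.val_one, one_mul])
      have hZ' := hZ 1 1
      simp only [one_mul, mul_one] at hZ'
      have hZ1 : 1 ≤ Z := hZ'.1 ⟨m - 1, by
        simp only [Nat.sub_add_cancel h0, ← Units.val_pow_eq_pow_val, h1, Units.val_one]⟩
      have hgZ : (g : M) ≤ Z := hZ'.1 ⟨0, by simp⟩
      refine ⟨Z * Y, one_le_mul hZ1 hY1, ?_⟩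
      rintro x (rfl | hx)
      · exact hgZ.trans (le_mul_of_one_le_right' hY1)
      · exact (hY x hx).trans (le_mul_of_one_le_left' hZ1)
  obtain ⟨Y, hY1, hY⟩ := hb _ (Set.toFinite (piElements πᶜ Mˣ)) subset_rfl
  have hpow : ∀ g ∈ Subgroup.normalClosure (piElements πᶜ Mˣ), ∃ n : ℕ, (g : M) ≤ Y ^ n := by
    intro g hg
    have hconj : Group.conjugatesOfSet (piElements πᶜ Mˣ) ⊆ piElements πᶜ Mˣ := by
      intro x hx
      obtain ⟨y, hy, hxy⟩ := Group.mem_conjugatesOfSet_iff.1 hx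
      obtain ⟨h, rfl⟩ := isConj_iff.1 hxy
      exact conj_mem_piElements hy h
    rw [Subgroup.normalClosure, ← Subgroup.mem_toSubmonoid, Subgroup.closure_toSubmonoid_of_finite]
      at hg
    induction hg using Submonoid.closure_induction with
    | mem x hx => exact ⟨1, by rw [pow_one]; exact hY x (hconj hx)⟩
    | one => exact ⟨0, by simp⟩
    | mul x y _ _ hx hy =>
      obtain ⟨a, ha⟩ := hx
      obtain ⟨b, hb⟩ := hy
      exact ⟨a + b, by rw [Units.val_mul, pow_add]; exact mul_le_mul' ha hb⟩
  choose! f hf using hpow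
  -- Since `1 ≤ Y`, the powers of `Y` increase; finitely many units need only one exponent.
  obtain ⟨n, hn⟩ := (Set.finite_range f).bddAbove
  exact ⟨Y ^ n, fun g hg => (hf g hg).trans (pow_le_pow_right' hY1 (hn ⟨g, rfl⟩))⟩

/-! ### Bounded fibres by induction on the monoid and the alphabet -/

/-- The map `w ↦ (w.map ψ).prod` has its fibres bounded above with respect to `α`. -/
def BoundedFibers {A N : Type*} [Monoid N] (α : A → M) (ψ : A → N) : Prop :=
  ∀ n, ∃ Y : M, ∀ w : List A, (w.map ψ).prod = n → (w.map α).prod ≤ Y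

/-- Words over `M` map to a `π`-aperiodic monoid with fibres bounded above in `M`. -/
def HasBoundedFibers (π : Set Nat.Primes) {A : Type u} (α : A → M) : Prop :=
  ∃ (N : Type u) (_ : Monoid N), Finite N ∧ PiAperiodic π N ∧
    ∃ ψ : A → N, BoundedFibers α ψ

theorem PiComplete.hasBoundedFibers_of_isUnit [Finite M] (hM : PiComplete π M) {A : Type u}
    (α : A → M) (h : ∀ a, IsUnit (α a)) : HasBoundedFibers π α := by
  obtain ⟨Y, hY⟩ := hM.exists_bound_normalClosure
  choose β hβ using h
  obtain rfl : (fun a => (β a : M)) = α := funext hβ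
  set K := Subgroup.normalClosure (piElements πᶜ Mˣ)
  refine ⟨Mˣ ⧸ K, inferInstance, inferInstance, piAperiodic_quotient π Mˣ,
    fun a => (β a : Mˣ ⧸ K), fun n => ?_⟩
  obtain ⟨g, rfl⟩ := QuotientGroup.mk_surjective n
  refine ⟨g * Y, fun w hw => ?_⟩
  have h1 : (w.map fun a => (β a : M)).prod = ((w.map β).prod : Mˣ) := by
    rw [← Units.coeHom_apply, map_list_prod, List.map_map]
    rfl
  have h2 : (w.map fun a => (β a : Mˣ ⧸ K)).prod = ((w.map β).prod : Mˣ) := by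
    rw [← QuotientGroup.mk'_apply, map_list_prod, List.map_map]
    rfl
  rw [h2] at hw
  have h3 := hY _ (QuotientGroup.eq.1 hw.symm)
  rw [h1]
  calc (((w.map β).prod : Mˣ) : M) = g * ((g⁻¹ * (w.map β).prod : Mˣ) : M) := by
        rw [← Units.val_mul, mul_inv_cancel_left]
    _ ≤ g * Y := mul_le_mul_right h3 _

/-- Splitting words at the letter `c`. -/
theorem hasBoundedFibers_of_localDivisor {A : Type u} (α : A → M) (c : A)
    (hB : HasBoundedFibers π fun a : {a // a ≠ c} => α a)
    (hD : ∀ (D : Type u) [Finite D] (β : D → LocalDivisor (α c)), HasBoundedFibers π β) :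
    HasBoundedFibers π α := by
  classical
  obtain ⟨B, _, hBfin, hBπ, ψ, hψ⟩ := hB
  choose Y hY using hψ
  set αB : List {a // a ≠ c} → M := fun u => (u.map fun a : {a // a ≠ c} => α a).prod with hαB
  set ψB : List {a // a ≠ c} → B := fun u => (u.map ψ).prod
  have hY' : ∀ u, αB u ≤ Y (ψB u) := fun u => hY _ u rfl
  -- The values of inner blocks are the new letters. In the local divisor, `c Y c ∘ c Y' c = c Y c
  -- Y' c` (writing `c` for `α c`), so adjacent blocks share a single `c`.
  let β : B → LocalDivisor (α c) := fun b =>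
    ⟨α c * Y b * α c, ⟨_, rfl⟩, Y b * α c, mul_assoc _ _ _⟩
  obtain ⟨D, _, hDfin, hDπ, f, hf⟩ := hD B β
  choose Z hZ using hf
  let χ : A → ReesExtension f := fun a =>
    if h : a = c then .high 1 1 1 else .low (ψ ⟨a, h⟩)
  have hblocks : ∀ l : List (List {a // a ≠ c}),
      α c * (l.map fun u => αB u * α c).prod ≤ (Z ((l.map fun u => f (ψB u)).prod)).val := by
    intro l
    have h1 : α c * (l.map fun u => αB u * α c).prod ≤ ((l.map fun u => β (ψB u)).prod).val := by
      induction l with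
      | nil => simp [LocalDivisor.one_val]
      | cons u l ih =>
        rw [List.map_cons, List.prod_cons, List.map_cons, List.prod_cons,
          LocalDivisor.mul_val_of_left (β (ψB u)) _ (u := α c * Y (ψB u)) rfl]
        rw [show α c * (αB u * α c * (l.map fun u => αB u * α c).prod) =
          (α c * αB u) * (α c * (l.map fun u => αB u * α c).prod) by simp only [mul_assoc]]
        exact mul_le_mul' (mul_le_mul_right (hY' u) _) ih
    have h2 := hZ _ (l.map ψB) rfl
    rw [List.map_map, List.map_map] at h2
    exact h1.trans h2
  -- A word either avoids `c` or is `u c u₁ c ⋯ c uₖ c u'` with all blocks free of `c`. Prepending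
  -- `c` to a word of the second kind turns its first block into an inner one.
  have hsplit : ∀ w : List A,
      (∃ u, (w.map χ).prod = .low (ψB u) ∧ (w.map α).prod = αB u) ∨
      ∃ (u : List {a // a ≠ c}) (l : List (List {a // a ≠ c})) (u' : List {a // a ≠ c}),
        (w.map χ).prod = .high (ψB u) ((l.map fun u => f (ψB u)).prod) (ψB u') ∧
        (w.map α).prod = αB u * (α c * (l.map fun u => αB u * α c).prod) * αB u' := by
    intro w
    induction w with
    | nil => exact .inl ⟨[], rfl, rfl⟩
    | cons a w ih =>
      rw [List.map_cons, List.prod_cons, List.map_cons, List.prod_cons]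
      by_cases h : a = c
      · have hχ : χ a = .high 1 1 1 := dif_pos h
        right
        rcases ih with ⟨u, h1, h2⟩ | ⟨u, l, u', h1, h2⟩
        · refine ⟨[], [], u, ?_, ?_⟩
          · rw [hχ, h1, ReesExtension.high_mul_low, one_mul]; rfl
          · rw [h2, h]; simp [hαB]
        · refine ⟨[], u :: l, u', ?_, ?_⟩
          · rw [hχ, h1, ReesExtension.high_mul_high, one_mul, one_mul]; rfl
          · rw [h2, h, List.map_cons, List.prod_cons]; simp [hαB, mul_assoc]
      · have hχ : χ a = .low (ψ ⟨a, h⟩) := dif_neg h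
        rcases ih with ⟨u, h1, h2⟩ | ⟨u, l, u', h1, h2⟩
        · refine .inl ⟨⟨a, h⟩ :: u, ?_, ?_⟩
          · rw [hχ, h1, ReesExtension.low_mul_low]; rfl
          · rw [h2]; simp [hαB]
        · refine .inr ⟨⟨a, h⟩ :: u, l, u', ?_, ?_⟩
          · rw [hχ, h1, ReesExtension.low_mul_high]; rfl
          · rw [h2]; simp [hαB, mul_assoc]
  refine ⟨ReesExtension f, inferInstance, inferInstance, ReesExtension.piAperiodic hBπ hDπ, χ,
    fun n => ?_⟩
  cases n with
  | low b =>
    refine ⟨Y b, fun w hw => ?_⟩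
    rcases hsplit w with ⟨u, h1, h2⟩ | ⟨u, l, u', h1, h2⟩
    · rw [hw] at h1
      rw [h2, ReesExtension.low.inj h1]
      exact hY' u
    · rw [hw] at h1
      cases h1
  | high x d y =>
    refine ⟨Y x * (Z d).val * Y y, fun w hw => ?_⟩
    rcases hsplit w with ⟨u, h1, h2⟩ | ⟨u, l, u', h1, h2⟩
    · rw [hw] at h1
      cases h1
    · rw [hw] at h1
      obtain ⟨hx, hd, hy⟩ := ReesExtension.high.inj h1
      rw [h2, hx, hd, hy]
      exact mul_le_mul' (mul_le_mul' (hY' u) (hblocks l)) (hY' u')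

/-- The outer induction on the size of `M` leaves the alphabet arbitrary, because the new alphabet
for the local divisor may be larger than `A`. The inner induction removes letters. -/
theorem hasBoundedFibers_of_card (π : Set Nat.Primes) (m : ℕ) :
    ∀ (k : ℕ) (M : Type u) [Monoid M] [PartialOrder M] [MulLeftMono M] [MulRightMono M] [Finite M]
      (A : Type u) [Finite A] (α : A → M), PiComplete π M → Nat.card M = m → Nat.card A = k →
      HasBoundedFibers π α := by
  induction m using Nat.strong_induction_on with
  | _ m ihm =>
    intro k
    induction k with
    | zero =>
      intro M _ _ _ _ _ A _ α hM _ hA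
      have : IsEmpty A := Finite.card_eq_zero_iff.1 hA
      exact hM.hasBoundedFibers_of_isUnit α isEmptyElim
    | succ k ihk =>
      intro M _ _ _ _ _ A _ α hM hMm hA
      classical
      by_cases h : ∀ a, IsUnit (α a)
      · exact hM.hasBoundedFibers_of_isUnit α h
      push Not at h
      obtain ⟨c, hc⟩ := h
      refine hasBoundedFibers_of_localDivisor α c ?_ fun D _ β => ?_
      · refine ihk M _ _ hM hMm ?_
        have : Nat.card {a // a ≠ c} + 1 = Nat.card A := by
          rw [← Finite.card_option, Nat.card_congr (Equiv.optionSubtypeNe c)]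
        omega
      · exact ihm _ (hMm ▸ LocalDivisor.card_lt hc) _ _ _ β (LocalDivisor.piComplete hM _) rfl rfl

/-! ### The ordered monoid of `CP` and the covering of pointlike sets -/

/-- For inclusion the join is the union, and products of sets distribute over unions. -/
theorem piComplete_submonoid_set {π : Set Nat.Primes} {R : Type*} [Monoid R]
    (P : Submonoid (Set R))
    (hP : ∀ z ∈ P, ∀ m, 0 < m → IsPiNumber πᶜ m → z ^ (m + 1) = z → ⋃ n : ℕ, z ^ (n + 1) ∈ P) :
    PiComplete π P := by
  intro z m hm hmπ hz
  refine ⟨⟨_, hP z z.2 m hm hmπ (congrArg Subtype.val hz)⟩, fun a b => ?_⟩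
  have key : (a : Set R) * (⋃ n : ℕ, (z : Set R) ^ (n + 1)) * (b : Set R) =
      ⋃ n : ℕ, (a : Set R) * (z : Set R) ^ (n + 1) * (b : Set R) := by
    rw [Set.mul_iUnion, Set.iUnion_mul]
  constructor
  · rintro _ ⟨n, rfl⟩
    change (a : Set R) * (z : Set R) ^ (n + 1) * (b : Set R) ⊆
      (a : Set R) * (⋃ n : ℕ, (z : Set R) ^ (n + 1)) * (b : Set R)
    rw [key]
    exact Set.subset_iUnion (fun n : ℕ => (a : Set R) * (z : Set R) ^ (n + 1) * (b : Set R)) n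
  · intro d hd
    change (a : Set R) * (⋃ n : ℕ, (z : Set R) ^ (n + 1)) * (b : Set R) ⊆ (d : Set R)
    rw [key]
    exact Set.iUnion_subset fun n => hd ⟨n, rfl⟩

section

variable {π : Set Nat.Primes} {T : Type u} [Semigroup T]

/-- Here `Z ^ ω = Z ^ m` is the identity of the cyclic group generated by `Z`, so it is absorbed by
the union. -/
theorem omegaPlusStar_eq_iUnion [Finite T] {Z : Set T} {m : ℕ} (hm : 0 < m) (h : posPow Z m = Z) :
    omegaPlusStar Z = ⋃ n : ℕ, posPow Z n := by
  have per : ∀ n, posPow Z (n + 1 * m) = posPow Z n := fun n =>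
    posPow_add_mul (k := 0) (by rw [zero_add, h]; rfl) n 1 (Nat.zero_le n)
  have hid : IsIdempotentElem (posPow Z (m - 1)) := by
    rw [IsIdempotentElem, posPow_mul_posPow, show m - 1 + (m - 1) + 1 = m - 1 + 1 * m by omega, per]
  have he : omegaPow Z = posPow Z (m - 1) :=
    idempotent_posPow_unique Z _ _ (omegaPow_spec Z).1 hid (omegaPow_spec Z).2 ⟨_, rfl⟩
  rw [omegaPlusStar, he, Set.mul_iUnion]
  refine Set.iUnion_congr fun n => ?_
  rw [posPow_mul_posPow, show m - 1 + n + 1 = n + 1 * m by omega, per]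

/-- The image map to the power semigroup of `T` with an identity adjoined. -/
def imageWithOne (T : Type u) [Semigroup T] : Set T →ₙ* Set (WithOne T) where
  toFun X := WithOne.coeMulHom '' X
  map_mul' _ _ := Set.image_mul WithOne.coeMulHom

theorem imageWithOne_injective : Function.Injective (imageWithOne T) :=
  Set.image_injective.2 WithOne.coe_injective

theorem RelMorphism.posPow_subset_inv {S : Type v} [Semigroup S] (φ : RelMorphism T S) {Z : Set T}
    {s : S} (h : Z ⊆ φ.inv s) (n : ℕ) : posPow Z n ⊆ φ.inv (posPow s n) := by
  induction n with
  | zero => exact h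
  | succ n ih =>
    rintro _ ⟨z, hz, z', hz', rfl⟩
    exact φ.mul (ih hz) (h hz')

/-- Pointlike sets are covered in all `π`-aperiodic finite semigroups, in every universe. -/
theorem exists_subset_inv_of_mem_pointlikes {X : Set T}
    (hX : X ∈ pointlikes.{u, v} (GBar.{v} π) T) {S : Type*} [Semigroup S] [Finite S]
    (hS : PiAperiodic π S) (φ : RelMorphism T S) : ∃ s, X ⊆ φ.inv s := by
  obtain ⟨R, ⟨e⟩⟩ : ∃ R : Type v, Nonempty (R ≃ S) :=
    ⟨ULift.{v} (Fin (Nat.card S)), ⟨Equiv.ulift.trans (Finite.equivFin S).symm⟩⟩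
  have : Finite R := .of_equiv S e.symm
  letI : Semigroup R := e.semigroup
  let f : R ≃* S := e.mulEquiv
  obtain ⟨s, hs⟩ := hX R (hS.of_injective f.toMulHom f.injective).gBar
    { rel := fun t s => φ.rel t (f s)
      total := fun t => (φ.total t).imp' f.symm fun s h => by rwa [f.apply_symm_apply]
      mul := fun h h' => by rw [map_mul]; exact φ.mul h h' }
  exact ⟨f s, hs⟩

variable [Finite T]

theorem singleton_mem_CP (t : T) : {t} ∈ CP π T :=
  Subsemigroup.mem_sInf.2 fun _ hU => hU.1 t

theorem omegaPlusStar_mem_CP {Z : Set T} (hZ : Z ∈ CP π T) (h : GeneratesPiGroup πᶜ Z) :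
    omegaPlusStar Z ∈ CP π T :=
  Subsemigroup.mem_sInf.2 fun U hU => hU.2 Z (Subsemigroup.mem_sInf.1 hZ U hU) h

theorem iUnion_posPow_mem_CP {Z : Set T} (hZ : Z ∈ CP π T) {m : ℕ} (hm : 0 < m)
    (hmπ : IsPiNumber πᶜ m) (h : posPow Z m = Z) : ⋃ n : ℕ, posPow Z n ∈ CP π T := by
  rw [← omegaPlusStar_eq_iUnion hm h]
  exact omegaPlusStar_mem_CP hZ ⟨isSubgroup_closure_singleton hm h,
    hmπ.of_dvd (card_closure_singleton_dvd hm h)⟩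

/-- `CP π T` with an identity adjoined, as a submonoid of the subsets of `WithOne T`. -/
def CPWithOne (π : Set Nat.Primes) (T : Type u) [Semigroup T] [Finite T] :
    Submonoid (Set (WithOne T)) where
  carrier := {X | X = 1 ∨ ∃ Y ∈ CP π T, X = imageWithOne T Y}
  one_mem' := .inl rfl
  mul_mem' := by
    rintro _ _ (rfl | ⟨Y, hY, rfl⟩) (rfl | ⟨Z, hZ, rfl⟩)
    · exact .inl (one_mul 1)
    · exact .inr ⟨Z, hZ, one_mul _⟩
    · exact .inr ⟨Y, hY, mul_one _⟩
    · exact .inr ⟨Y * Z, mul_mem hY hZ, (map_mul _ Y Z).symm⟩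

theorem piComplete_CPWithOne : PiComplete π (CPWithOne π T) := by
  refine piComplete_submonoid_set _ ?_
  rintro _ (rfl | ⟨Z, hZ, rfl⟩) m hm hmπ h
  · simp only [one_pow, Set.iUnion_const]
    exact one_mem _
  · refine .inr ⟨_, iUnion_posPow_mem_CP hZ hm hmπ ?_, ?_⟩
    · apply imageWithOne_injective
      rw [map_posPow, posPow_eq_pow, h]
    · simp only [← posPow_eq_pow, ← map_posPow]
      exact (Set.image_iUnion).symm

instance : MulLeftMono (CPWithOne π T) where
  elim _ _ _ h := Set.mul_subset_mul_left h

instance : MulRightMono (CPWithOne π T) where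
  elim _ _ _ h := Set.mul_subset_mul_right h

theorem exists_mem_CP_of_mem_pointlikes {X : Set T}
    (hX : X ∈ pointlikes.{u, v} (GBar.{v} π) T) : ∃ Y ∈ CP π T, X ⊆ Y := by
  obtain hT | ⟨⟨t₀⟩⟩ := isEmpty_or_nonempty T
  -- If `T` is empty, the empty relational morphism to `T` itself leaves no point `s`, so there are
  -- no pointlike sets.
  · obtain ⟨s, -⟩ := exists_subset_inv_of_mem_pointlikes (S := T) hX
      (fun _ _ z => isEmptyElim z) ⟨fun _ _ => True, isEmptyElim, fun _ _ => trivial⟩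
    exact isEmptyElim s
  have : Finite (WithOne T) := inferInstanceAs (Finite (Option T))
  let α : T → CPWithOne π T := fun t =>
    ⟨imageWithOne T {t}, .inr ⟨_, singleton_mem_CP t, rfl⟩⟩
  have hα : ∀ w : List T, ((w.map α).prod : Set (WithOne T)) =
      {(w.map fun t : T => (t : WithOne T)).prod} := by
    intro w
    induction w with
    | nil => exact Set.singleton_one.symm
    | cons t w ih =>
      rw [List.map_cons, List.prod_cons, Submonoid.coe_mul, ih, List.map_cons, List.prod_cons,
        ← Set.singleton_mul_singleton]
      exact congrArg (· * _) Set.image_singleton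
  obtain ⟨N, _, _, hN, ψ, hψ⟩ :=
    hasBoundedFibers_of_card π _ _ _ _ α piComplete_CPWithOne rfl rfl
  obtain ⟨n, hn⟩ := exists_subset_inv_of_mem_pointlikes hX hN
    { rel := fun t n => ∃ w : List T, (w.map fun t : T => (t : WithOne T)).prod = t ∧
        (w.map ψ).prod = n
      total := fun t => ⟨ψ t, [t], by simp, by simp⟩
      mul := by
        rintro t t' _ _ ⟨w, hw, rfl⟩ ⟨w', hw', rfl⟩
        exact ⟨w ++ w', by rw [List.map_append, List.prod_append, hw, hw', WithOne.coe_mul],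
          by rw [List.map_append, List.prod_append]⟩ }
  obtain ⟨Y, hY⟩ := hψ n
  have hXY : ∀ x ∈ X, (x : WithOne T) ∈ (Y : Set (WithOne T)) := by
    intro x hx
    obtain ⟨w, hw, hwn⟩ := hn hx
    have h : ((w.map α).prod : Set (WithOne T)) ⊆ Y := hY w hwn
    rw [hα, hw] at h
    exact h rfl
  obtain ⟨Y, rfl | ⟨Z, hZ, rfl⟩⟩ := Y
  -- When the bound is the adjoined identity `{1}`, the set `X` is empty and any singleton covers
  -- it.
  · exact ⟨{t₀}, singleton_mem_CP t₀, fun x hx => absurd (hXY x hx) WithOne.coe_ne_one⟩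
  · refine ⟨Z, hZ, fun x hx => ?_⟩
    obtain ⟨z, hz, h⟩ := hXY x hx
    rwa [← WithOne.coe_injective h]

/-! ### Members of `CP` are pointlike -/

/-- The subsets of `T` contained in some `s φ⁻¹`. -/
def RelMorphism.covered {S : Type v} [Semigroup S] (φ : RelMorphism T S) :
    Subsemigroup (Set T) where
  carrier := {Z | ∃ s, Z ⊆ φ.inv s}
  mul_mem' := by
    rintro Z Z' ⟨s, hs⟩ ⟨s', hs'⟩
    refine ⟨s * s', ?_⟩
    rintro _ ⟨z, hz, z', hz', rfl⟩
    exact φ.mul (hs hz) (hs' hz')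

theorem GBar.omegaPlusStar_mem_covered {S : Type v} [Semigroup S] (hS : GBar π S)
    (φ : RelMorphism T S) {Z : Set T} (hZ : Z ∈ φ.covered) (h : GeneratesPiGroup πᶜ Z) :
    omegaPlusStar Z ∈ φ.covered := by
  obtain ⟨s, hs⟩ := hZ
  obtain ⟨k, r, hr, hrπ, hper⟩ := hS.exists_period s
  obtain ⟨hm, hm0⟩ := h.1.posPow_card (Subsemigroup.subset_closure rfl)
  have hmπ : IsPiNumber πᶜ _ := h.2
  set m := Nat.card (Subsemigroup.closure {Z})
  have hle : k + 1 ≤ r * (k + 1) := Nat.le_mul_of_pos_left _ hr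
  -- This is `s ^ (r * (k + 1))`: the exponent is a multiple of `r` beyond the preperiod, where all
  -- such powers of `s` agree.
  refine ⟨posPow s (r * (k + 1) - 1), ?_⟩
  rw [omegaPlusStar_eq_iUnion hm0 hm]
  refine Set.iUnion_subset fun n => ?_
  -- The exponent `n + 1` of `Z` is moved modulo `m` to a large multiple of `r`, which does not
  -- change the power of `Z`.
  obtain ⟨j, hj, q, hq⟩ := exists_add_mul_dvd hr hm0 (hrπ.coprime hmπ) (n + 1) (k + 1)
  have h1 : posPow Z (n + j * m) = posPow Z n :=
    posPow_add_mul (k := 0) (by rw [zero_add, hm]; rfl) n j (Nat.zero_le n)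
  have h2 : posPow s (n + j * m) = posPow s (r * (k + 1) - 1) := by
    rw [← posPow_add_mul hper (n + j * m) (k + 1) (by omega),
      ← posPow_add_mul hper (r * (k + 1) - 1) q (by omega)]
    congr 1
    rw [mul_comm q r, ← hq, mul_comm (k + 1) r]
    omega
  rw [← h1, ← h2]
  exact φ.posPow_subset_inv hs _

theorem mem_pointlikes_of_mem_CP {Y : Set T} (hY : Y ∈ CP π T) :
    Y ∈ pointlikes.{u, v} (GBar.{v} π) T := by
  intro S _ hS φ
  refine Subsemigroup.mem_sInf.1 hY φ.covered
    ⟨fun t => ?_, fun Z hZ h => hS.omegaPlusStar_mem_covered φ hZ h⟩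
  obtain ⟨s, hs⟩ := φ.total t
  exact ⟨s, Set.singleton_subset_iff.2 hs⟩

end

end PiPointlike

theorem mainTheorem1 (π : Set Nat.Primes) (T : Type u) [Semigroup T] [Finite T] :
    PiPointlike.pointlikes.{u, v} (PiPointlike.GBar.{v} π) T =
      {X : Set T | ∃ Y ∈ PiPointlike.CP π T, X ⊆ Y} := by
  ext X
  refine ⟨PiPointlike.exists_mem_CP_of_mem_pointlikes, ?_⟩
  rintro ⟨Y, hY, hXY⟩ S _ hS φ
  obtain ⟨s, hs⟩ := PiPointlike.mem_pointlikes_of_mem_CP hY S hS φ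
  exact ⟨s, hXY.trans hs⟩
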